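/- Let $\mathbf{Z}[\mathbb{R}]$ denote the collection of zero sets $\mathbf{Z}(f)=\{x\in\mathbb{R}: f(x)=0\}$ of continuous functions $f$ on $\mathbb{R}$. A $z$-filter on $\mathbb{R}$ is a non-empty proper subset of $\mathbf{Z}[\mathbb{R}]$ that is closed under finite intersections and under supersets in $\mathbf{Z}[\mathbb{R}]$. A $z$-filter $\mathcal{P}$ is prime if $Z_1\cup Z_2\notin\mathcal{P}$ whenever $Z_1,Z_2\in\mathbf{Z}[\mathbb{R}]\setminus\mathcal{P}$; a prime $z$-filter is non-minimal if it properly contains another prime $z$-filter. Let $\mathcal{C}_0(\mathbb{R})$ be the algebra of continuous (real-valued or complex-valued) functions on $\mathbb{R}$ vanishing at infinity. An ideal $P$ of $\mathcal{C}_0(\mathbb{R})$ is prime if it is proper and $fg\in P$ implies $f\in P$ or $g\in P$; it is a $z$-ideal if $g\in P$ whenever $g\in\mathcal{C}_0(\mathbb{R})$ and $\mathbf{Z}(g)\supseteq\mathbf{Z}(f)$ for some $f\in P$; a prime $z$-ideal is non-minimal if it properly contains another prime ideal. Let $\kappa$ be any ordinal of cardinality $\mathfrak{c}=2^{\aleph_0}$.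 Then: (i) For every non-minimal prime $z$-filter $\mathcal{P}$ on $\mathbb{R}$ there is a family $(\mathcal{Q}_\alpha)_{\alpha<\kappa}$ of prime $z$-filters on $\mathbb{R}$ such that $\mathcal{Q}_0=\mathcal{P}$ and $\mathcal{Q}_\beta\subsetneq\mathcal{Q}_\alpha$ whenever $\alpha<\beta<\kappa$. (ii) For every non-minimal prime $z$-ideal $P$ of $\mathcal{C}_0(\mathbb{R})$ there is a family $(Q_\alpha)_{\alpha<\kappa}$ of prime $z$-ideals of $\mathcal{C}_0(\mathbb{R})$ such that $Q_0=P$ and $Q_\beta\subsetneq Q_\alpha$ whenever $\alpha<\beta<\kappa$. -/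

import Mathlib

open scoped ZeroAtInfty

universe u v

namespace PrimeZ

/-- `Z[Ω]`: the collection of the zero sets of the continuous real functions on `Ω`. (Complex
functions have the same zero sets, since `f` and `|f|` vanish at the same points.) -/
def zeroSets (Ω : Type*) [TopologicalSpace Ω] : Set (Set Ω) :=
  {Z | ∃ f : C(Ω, ℝ), Z = {x | f x = 0}}

/-- A `z`-filter on `Ω`: a non-empty proper subset of `Z[Ω]` closed under finite intersections and
under supersets in `Z[Ω]`. -/
structure IsZFilter {Ω : Type*} [TopologicalSpace Ω] (F : Set (Set Ω)) : Prop where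
  nonempty : F.Nonempty
  ssubset : F ⊂ zeroSets Ω
  inter_mem : ∀ Z ∈ F, ∀ W ∈ F, Z ∩ W ∈ F
  superset_mem : ∀ Z ∈ F, ∀ W ∈ zeroSets Ω, Z ⊆ W → W ∈ F

/-- A prime `z`-filter: zero sets `Z`, `W` outside of it have their union outside of it. -/
structure IsPrimeZFilter {Ω : Type*} [TopologicalSpace Ω] (F : Set (Set Ω)) : Prop where
  isZFilter : IsZFilter F
  union_notMem : ∀ Z ∈ zeroSets Ω, ∀ W ∈ zeroSets Ω, Z ∉ F → W ∉ F → Z ∪ W ∉ F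

/-- A prime ideal of the commutative (possibly non-unital) ring `R`: a proper ideal that contains
one of the factors of any product that it contains. -/
structure IsPrimeIdeal {R : Type*} [NonUnitalCommRing R] (I : TwoSidedIdeal R) : Prop where
  ne_top : I ≠ ⊤
  mem_or_mem : ∀ f g : R, f * g ∈ I → f ∈ I ∨ g ∈ I

/-- A `z`-ideal of `C₀(Ω, 𝕜)`: with `f` it contains all `g` that vanish wherever `f` does. -/
def IsZIdeal {Ω 𝕜 : Type*} [TopologicalSpace Ω] [RCLike 𝕜] (I : TwoSidedIdeal C₀(Ω, 𝕜)) : Prop :=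
  ∀ f ∈ I, ∀ g : C₀(Ω, 𝕜), {x | f x = 0} ⊆ {x | g x = 0} → g ∈ I

end PrimeZ

/-! ### Prime filters of closed sets. -/

namespace PrimeZ

open Set Filter Topology

/-! Zero sets of `ℝ` are the closed sets, also for functions of `C₀(ℝ, 𝕜)`, so both claims concern
prime filters of closed sets. If `P` properly contains a prime `P'` and `Z ∈ P \ P'`, then `closure
Zᶜ ∈ P' ⊆ P`, hence `P` contains the nowhere dense set `N = Z ∩ closure Zᶜ`.

By the prime ideal theorem, `closure (A \ E) ∈ P` yields a prime filter below `P` containing `A` but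
not `E` (`exists_subset`). Iterating, `chainSet [E₁, …, Eₙ] ∈ P` yields a finite chain separated by
the `Eᵢ`. Finite chains merge along an ultrafilter into one indexed by any linear order
(`exists_chain`).

It remains to find continuum many closed `E` such that `chainSet` of any distinct ones, in any
order, contains `N` (`subset_chainSet`). Nowhere dense sets `N = T₀ ⊆ T₁ ⊆ …` are built with `Tⱼ ⊆
closure (Tⱼ₊₁ \ Tⱼ)`. Disjoint shells accumulate at `N`, and `E` agrees with `T_{c k}` in the `k`-th
shell. The functions `c` form an independent family: any finite list of them takes the values `1, 2,
3, …` in order for infinitely many `k`. -/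

/-- A prime filter of the lattice of closed sets of a topological space. -/
structure IsPrimeClosedFilter {X : Type*} [TopologicalSpace X] (F : Set (Set X)) : Prop where
  isClosed : ∀ Z ∈ F, IsClosed Z
  univ_mem : univ ∈ F
  empty_notMem : ∅ ∉ F
  inter_mem : ∀ Z ∈ F, ∀ W ∈ F, Z ∩ W ∈ F
  superset_mem : ∀ Z ∈ F, ∀ W, IsClosed W → Z ⊆ W → W ∈ F
  mem_or_mem : ∀ Z W, IsClosed Z → IsClosed W → Z ∪ W ∈ F → Z ∈ F ∨ W ∈ F

namespace IsPrimeClosedFilter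

variable {X : Type*} [TopologicalSpace X]

/-- A prime filter of closed sets that contains `closure (A \ E)` contains a prime filter that
contains `A` but not `E`. -/
theorem exists_subset {P : Set (Set X)} (hP : IsPrimeClosedFilter P)
    {A E : Set X} (hA : IsClosed A) (hE : IsClosed E) (h : closure (A \ E) ∈ P) :
    ∃ Q, IsPrimeClosedFilter Q ∧ Q ⊆ P ∧ A ∈ Q ∧ E ∉ Q := by
  let F : Order.PFilter (TopologicalSpace.Closeds X) := Order.PFilter.principal ⟨A, hA⟩
  -- The ideal generated by `E` and the closed sets outside `P`: the complement of a prime ideal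
  -- above it omits `E` and lies in `P`.
  let I : Order.Ideal (TopologicalSpace.Closeds X) :=
    { carrier := {Z | ∃ W, IsClosed W ∧ W ∉ P ∧ (Z : Set X) ⊆ E ∪ W}
      lower' := by
        rintro Z Z' hle ⟨W, hW, hWP, hZ⟩
        exact ⟨W, hW, hWP, fun x hx => hZ (hle hx)⟩
      nonempty' := ⟨⊥, ∅, isClosed_empty, hP.empty_notMem, by simp⟩
      directed' := by
        rintro Z ⟨W, hW, hWP, hZ⟩ Z' ⟨W', hW', hWP', hZ'⟩
        refine ⟨Z ⊔ Z', ⟨W ∪ W', hW.union hW', ?_, ?_⟩, le_sup_left, le_sup_right⟩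
        · intro hmem
          exact (hP.mem_or_mem _ _ hW hW' hmem).elim hWP hWP'
        · rintro x (hx | hx)
          · exact (hZ hx).imp id Or.inl
          · exact (hZ' hx).imp id Or.inr }
  have hFI : Disjoint (F : Set (TopologicalSpace.Closeds X)) (I : Set _) := by
    rw [Set.disjoint_left]
    rintro Z hZ ⟨W, hW, hWP, hZW⟩
    have hAZ : A ⊆ Z := hZ
    refine hWP (hP.superset_mem _ h _ hW (closure_minimal ?_ hW))
    rintro x ⟨hxA, hxE⟩
    exact (hZW (hAZ hxA)).resolve_left hxE
  obtain ⟨J, hJ, hIJ, hFJ⟩ := DistribLattice.prime_ideal_of_disjoint_filter_ideal hFI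
  have key : ∀ {Z : Set X} (hZ : IsClosed Z),
      Z ∈ ((fun C : TopologicalSpace.Closeds X => (C : Set X)) '' (J : Set _)ᶜ) ↔
        (⟨Z, hZ⟩ : TopologicalSpace.Closeds X) ∉ J := by
    intro Z hZ
    constructor
    · rintro ⟨C, hC, rfl⟩
      exact hC
    · intro hC
      exact ⟨_, hC, rfl⟩
  have hAJ : (⟨A, hA⟩ : TopologicalSpace.Closeds X) ∉ J :=
    Set.disjoint_left.1 hFJ (show A ⊆ A from subset_rfl)
  refine ⟨(fun C : TopologicalSpace.Closeds X => (C : Set X)) '' (J : Set _)ᶜ, ?_, ?_, ?_, ?_⟩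
  · have hcl : ∀ Z ∈ ((fun C : TopologicalSpace.Closeds X => (C : Set X)) '' (J : Set _)ᶜ),
        IsClosed Z := by
      rintro _ ⟨C, -, rfl⟩
      exact C.isClosed
    refine ⟨hcl, ?_, ?_, ?_, ?_, ?_⟩
    · rw [key isClosed_univ]
      exact fun hmem => hAJ (J.lower (show A ⊆ univ from subset_univ _) hmem)
    · rw [key isClosed_empty, not_not]
      exact hIJ ⟨∅, isClosed_empty, hP.empty_notMem, by simp⟩
    · intro Z hZ W hW
      rw [key ((hcl Z hZ).inter (hcl W hW))]
      rw [key (hcl Z hZ)] at hZ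
      rw [key (hcl W hW)] at hW
      intro hmem
      exact (hJ.mem_or_mem (x := ⟨Z, _⟩) (y := ⟨W, _⟩) hmem).elim hZ hW
    · intro Z hZ W hW hZW
      rw [key hW]
      rw [key (hcl Z hZ)] at hZ
      exact fun hmem => hZ (J.lower (show Z ⊆ W from hZW) hmem)
    · intro Z W hZ hW hZW
      rw [key (hZ.union hW)] at hZW
      rw [key hZ, key hW]
      by_contra! hcon
      exact hZW (J.sup_mem hcon.1 hcon.2)
  · rintro _ ⟨C, hC, rfl⟩
    by_contra hCP
    exact hC (hIJ ⟨C, C.isClosed, hCP, subset_union_right⟩)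
  · rw [key hA]
    exact hAJ
  · rw [key hE, not_not]
    exact hIJ ⟨∅, isClosed_empty, hP.empty_notMem, by simp⟩

/-- The limit of prime filters along an ultrafilter is a prime filter. -/
theorem ultrafilter_limit {ι : Type*} (𝔘 : Ultrafilter ι) {Q : ι → Set (Set X)}
    (hQ : ∀ i, IsPrimeClosedFilter (Q i)) :
    IsPrimeClosedFilter {Z | ∀ᶠ i in 𝔘, Z ∈ Q i} where
  isClosed Z hZ := by
    obtain ⟨i, hi⟩ := Filter.Eventually.exists hZ
    exact (hQ i).isClosed Z hi
  univ_mem := Eventually.of_forall fun i => (hQ i).univ_mem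
  empty_notMem h := by
    obtain ⟨i, hi⟩ := Filter.Eventually.exists h
    exact (hQ i).empty_notMem hi
  inter_mem Z hZ W hW := by
    filter_upwards [hZ, hW] with i hi hi' using (hQ i).inter_mem Z hi W hi'
  superset_mem Z hZ W hW hZW := by
    filter_upwards [hZ] with i hi using (hQ i).superset_mem Z hi W hW hZW
  mem_or_mem Z W hZ hW h := by
    rw [mem_ofPred_eq, mem_ofPred_eq, ← Ultrafilter.eventually_or]
    filter_upwards [h] with i hi using (hQ i).mem_or_mem Z W hZ hW hi

end IsPrimeClosedFilter

/-! ### Chains indexed by a linear order. -/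

/-- Membership of this set in a prime filter of closed sets ensures the existence of a chain of
prime filters below it, from each of which the next one is separated by the next set of the
list. -/
def chainSet {X : Type*} [TopologicalSpace X] : List (Set X) → Set X
  | [] => univ
  | E :: l => E ∩ closure (chainSet l \ E)

theorem isClosed_chainSet {X : Type*} [TopologicalSpace X] :
    ∀ l : List (Set X), (∀ E ∈ l, IsClosed E) → IsClosed (chainSet l)
  | [], _ => isClosed_univ
  | E :: _, h => (h E (by simp)).inter isClosed_closure

/-- The chain is a step function on all of `I`, dropping just after each index in `l`. Being defined
off `l` too, such chains can be compared for different `l`. -/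
theorem exists_chain_of_sorted {X I : Type*} [TopologicalSpace X] [LinearOrder I]
    {E : I → Set X} (hE : ∀ i, IsClosed (E i)) (l : List I) (hl : l.Pairwise (· < ·))
    {P : Set (Set X)} (hP : IsPrimeClosedFilter P) (h : chainSet (l.map E) ∈ P) :
    ∃ Q : I → Set (Set X), (∀ i, IsPrimeClosedFilter (Q i)) ∧ Antitone Q ∧ (∀ i, Q i ⊆ P) ∧
      (∀ i, (∀ j ∈ l, i ≤ j) → Q i = P) ∧
      ∀ i ∈ l, E i ∈ Q i ∧ ∀ j, i < j → E i ∉ Q j := by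
  induction l generalizing P with
  | nil => exact ⟨fun _ => P, fun _ => hP, antitone_const, fun _ => subset_rfl, by simp, by simp⟩
  | cons a l ih =>
    rw [List.pairwise_cons] at hl
    have hmem : ∀ {s}, IsClosed s → chainSet ((a :: l).map E) ⊆ s → s ∈ P :=
      fun hs hsub => hP.superset_mem _ h _ hs hsub
    obtain ⟨R, hR, hRP, hRl, hRa⟩ := hP.exists_subset
      (isClosed_chainSet (l.map E) (by simp [hE])) (hE a)
      (hmem isClosed_closure inter_subset_right)
    obtain ⟨Q, hQ, hQanti, hQR, -, hQl⟩ := ih hl.2 hR hRl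
    refine ⟨fun i => if i ≤ a then P else Q i, ?_, ?_, ?_, ?_, ?_⟩
    · intro i
      dsimp only
      split_ifs
      exacts [hP, hQ i]
    · intro i j hij
      dsimp only
      split_ifs with hj hi hi
      · exact le_rfl
      · exact absurd (hij.trans hj) hi
      · exact (hQR j).trans hRP
      · exact hQanti hij
    · intro i
      dsimp only
      split_ifs
      exacts [subset_rfl, (hQR i).trans hRP]
    · intro i hi
      exact if_pos (hi a (by simp))
    · intro i hi
      rcases List.mem_cons.1 hi with rfl | hi
      · refine ⟨?_, fun j hj => ?_⟩
        · simp only [le_refl, if_true]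
          exact hmem (hE i) inter_subset_left
        · simp only [not_le.2 hj, if_false]
          exact fun hmem' => hRa (hQR j hmem')
      · have hai := hl.1 i hi
        refine ⟨?_, fun j hj => ?_⟩
        · simp only [not_le.2 hai, if_false]
          exact (hQl i hi).1
        · simp only [not_le.2 (hai.trans hj), if_false]
          exact (hQl i hi).2 j hj

/-- A compactness argument: the chains for finite subsets of `I` converge along an ultrafilter finer
than `atTop`. Each `i` is eventually in the finite set, so `E i` still separates the limit at `i`
from the later ones. -/
theorem exists_chain {X I : Type*} [TopologicalSpace X] [LinearOrder I]
    {E : I → Set X} (hE : ∀ i, IsClosed (E i)) {P : Set (Set X)} (hP : IsPrimeClosedFilter P)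
    (h : ∀ l : List I, l.Nodup → chainSet (l.map E) ∈ P) :
    ∃ Q : I → Set (Set X), StrictAnti Q ∧ (∀ i, IsPrimeClosedFilter (Q i)) ∧
      ∀ i, IsMin i → Q i = P := by
  classical
  have hsort : ∀ s : Finset I, (s.sort (· ≤ ·)).Pairwise (· < ·) :=
    fun s => s.sortedLT_sort.pairwise
  choose Q hQ hQanti hQP hQmin hQE using fun s : Finset I =>
    exists_chain_of_sorted hE (s.sort (· ≤ ·)) (hsort s) hP (h _ (s.sort_nodup _))
  let 𝔘 : Ultrafilter (Finset I) := Ultrafilter.of atTop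
  have hmem : ∀ i : I, ∀ᶠ s : Finset I in (𝔘 : Filter (Finset I)), i ∈ s := fun i =>
    Ultrafilter.of_le _ ((eventually_ge_atTop ({i} : Finset I)).mono
      fun s hs => Finset.singleton_subset_iff.1 hs)
  refine ⟨fun i => {Z | ∀ᶠ s in 𝔘, Z ∈ Q s i}, ?_,
    fun i => IsPrimeClosedFilter.ultrafilter_limit 𝔘 fun s => hQ s i, ?_⟩
  · intro i j hij
    rw [Set.ssubset_iff_of_subset]
    · refine ⟨E i, ?_, ?_⟩
      · filter_upwards [hmem i] with s hs using (hQE s i (by simpa using hs)).1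
      · intro hcon
        obtain ⟨s, hs, hs'⟩ := (Filter.Eventually.and hcon (hmem i)).exists
        exact (hQE s i (by simpa using hs')).2 j hij hs
    · intro Z hZ
      exact Filter.Eventually.mono hZ fun s hs => hQanti s hij.le hs
  · intro i hi
    have : ∀ s, Q s i = P := fun s => hQmin s i fun j _ => (le_total i j).elim id fun h => hi h
    ext Z
    simp [this]

end PrimeZ

namespace PrimeZ

open Set Filter Topology Metric

/-! ### An independent family of functions -/

/-- The first `m` terms of a sequence of bits. -/
def restrict (m : ℕ) (r : ℕ → Bool) : List ℕ := (List.range m).map fun n => (r n).toNat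

/-- Continuum many functions `ℕ → ℕ` that take independently of each other all positive values. -/
noncomputable def indep (r : ℕ → Bool) (k : ℕ) : ℕ :=
  -- The number `k` codes a length `m` and a list of bit strings, in which the position of the first
  -- `m` bits of `r` is looked up. Adding 1 avoids level 0 of the tower, which is `N` and misses all
  -- shells.
  (((Denumerable.ofNat (ℕ × List (List ℕ)) k).2).idxOf
    (restrict (Denumerable.ofNat (ℕ × List (List ℕ)) k).1 r)) + 1

theorem exists_injOn_restrict (l : List (ℕ → Bool)) :
    ∃ m₀, ∀ m ≥ m₀, ∀ r ∈ l, ∀ r' ∈ l, restrict m r = restrict m r' → r = r' := by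
  have h : ∀ r r' : ℕ → Bool, ∀ᶠ m in atTop,
      (restrict m r = restrict m r' → r = r') := by
    intro r r'
    by_cases hr : r = r'
    · exact Eventually.of_forall fun _ _ => hr
    · obtain ⟨n, hn⟩ := Function.ne_iff.1 hr
      filter_upwards [eventually_gt_atTop n] with m hm heq
      have hinj : Function.Injective Bool.toNat := by decide
      exact absurd (hinj (List.map_inj_left.1 heq n (List.mem_range.2 hm))) hn
  have h' : ∀ᶠ m in atTop, ∀ r ∈ {r | r ∈ l}, ∀ r' ∈ {r | r ∈ l},
      (restrict m r = restrict m r' → r = r') := by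
    rw [eventually_all_finite l.finite_toSet]
    intro r _
    rw [eventually_all_finite l.finite_toSet]
    intro r' _
    exact h r r'
  exact eventually_atTop.1 h'

/-- Each `m` large enough to tell the members of `l` apart gives such a `k`: the code of `m` with
the list of their restrictions. -/
theorem infinite_indep_eq (l : List (ℕ → Bool)) (hl : l.Nodup) :
    {k | ∀ i (h : i < l.length), indep l[i] k = i + 1}.Infinite := by
  obtain ⟨m₀, hm₀⟩ := exists_injOn_restrict l
  let e : ℕ → ℕ := fun m =>
    Encodable.encode ((m, l.map fun r => restrict m r) : ℕ × List (List ℕ))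
  have he : Function.Injective e := fun m m' h => congrArg Prod.fst (Encodable.encode_injective h)
  refine ((Set.Ici_infinite m₀).image he.injOn).mono ?_
  rintro _ ⟨m, hm, rfl⟩ i hi
  have hnd : (l.map fun r => restrict m r).Nodup :=
    hl.map_on fun r hr r' hr' h => hm₀ m hm r hr r' hr' h
  simp only [indep, e, Denumerable.ofNat_encode]
  have := hnd.idxOf_getElem i (by simpa using hi)
  simpa using this

/-! ### Iterated fattening of a nowhere dense set -/

/-- The range of the sequence `1, 1/4, 1/16, …` together with its limit. -/
def scale : Set ℝ := insert 0 (range fun k : ℕ => (1 / 4 : ℝ) ^ k)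

theorem isClosed_scale : IsClosed scale :=
  (tendsto_pow_atTop_nhds_zero_of_lt_one (r := (1 / 4 : ℝ)) (by norm_num)
    (by norm_num)).isCompact_insert_range.isClosed

theorem exists_notMem_scale {a b : ℝ} (h : a < b) : ∃ t ∈ Ioo a b, t ∉ scale := by
  have hc : scale.Countable := (countable_range _).insert 0
  obtain ⟨t, ht, hta⟩ := (hc.dense_compl ℝ).exists_mem_open isOpen_Ioo (nonempty_Ioo.2 h)
  exact ⟨t, hta, ht⟩

/-- The points at a distance from `M` that belongs to `scale`. -/
def fatten (M : Set ℝ) : Set ℝ := {x | infDist x M ∈ scale}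

theorem isClosed_fatten (M : Set ℝ) : IsClosed (fatten M) :=
  isClosed_scale.preimage (continuous_infDist_pt M)

theorem subset_fatten (M : Set ℝ) : M ⊆ fatten M := fun _ hx => Or.inl (infDist_zero_of_mem hx)

/-- Near each point of the nowhere dense set `M`, all small distances from `M` are attained. -/
theorem exists_infDist_eq {M : Set ℝ} (hM : IsClosed M) (hM' : M ⊆ closure Mᶜ) {p : ℝ} (hp : p ∈ M)
    {ε : ℝ} (hε : 0 < ε) : ∃ h > 0, ∀ s ∈ Icc 0 h, ∃ x, dist x p < ε ∧ infDist x M = s := by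
  obtain ⟨x, hx, hxp⟩ := Metric.mem_closure_iff.1 (hM' hp) ε hε
  refine ⟨infDist x M, (hM.notMem_iff_infDist_pos ⟨p, hp⟩).1 hx, fun s hs => ?_⟩
  have := intermediate_value_uIcc (a := p) (b := x) (f := fun y => infDist y M)
    (continuous_infDist_pt M).continuousOn
  rw [infDist_zero_of_mem hp, uIcc_of_le infDist_nonneg] at this
  obtain ⟨y, hy, hys⟩ := this hs
  refine ⟨y, lt_of_le_of_lt ?_ hxp, hys⟩
  rw [Real.dist_eq, Real.dist_eq, abs_sub_comm p x]
  exact abs_sub_left_of_mem_uIcc hy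

theorem subset_closure_fatten_diff {M : Set ℝ} (hM : IsClosed M) (hM' : M ⊆ closure Mᶜ) :
    M ⊆ closure (fatten M \ M) := by
  intro p hp
  rw [Metric.mem_closure_iff]
  intro ε hε
  obtain ⟨h, h0, hh⟩ := exists_infDist_eq hM hM' hp hε
  obtain ⟨k, hk⟩ := exists_pow_lt_of_lt_one h0 (show (1 / 4 : ℝ) < 1 by norm_num)
  obtain ⟨x, hxp, hx⟩ := hh ((1 / 4) ^ k) ⟨by positivity, hk.le⟩
  refine ⟨x, ⟨?_, ?_⟩, by rwa [dist_comm]⟩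
  · exact Or.inr ⟨k, hx.symm⟩
  · rw [hM.notMem_iff_infDist_pos ⟨p, hp⟩, hx]
    positivity

/-- As `scale` is countable, a slight change of the distance from `M` leaves it. Off `M`, the change
is made by moving towards a nearest point of `M`. -/
theorem fatten_subset_closure_compl {M : Set ℝ} (hM : IsClosed M) (hne : M.Nonempty)
    (hM' : M ⊆ closure Mᶜ) : fatten M ⊆ closure (fatten M)ᶜ := by
  intro x hx
  rw [Metric.mem_closure_iff]
  intro ε hε
  rcases (infDist_nonneg (x := x) (s := M)).eq_or_lt with h0 | h0
  · have hxM : x ∈ M := (hM.mem_iff_infDist_zero hne).2 h0.symm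
    obtain ⟨h, h0, hh⟩ := exists_infDist_eq hM hM' hxM hε
    obtain ⟨t, ht, hts⟩ := exists_notMem_scale h0
    obtain ⟨y, hyx, hy⟩ := hh t ⟨ht.1.le, ht.2.le⟩
    exact ⟨y, by simpa [fatten, hy] using hts, by rwa [dist_comm]⟩
  · obtain ⟨q, hq, hxq⟩ := hM.exists_infDist_eq_dist hne x
    set c := infDist x M with hc
    obtain ⟨t, ht, hts⟩ := exists_notMem_scale (show max 0 (c - ε) < c by simp [h0, hε])
    have ht0 : 0 < t := (le_max_left _ _).trans_lt ht.1
    have htε : c - ε < t := (le_max_right _ _).trans_lt ht.1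
    -- the point of the segment from `q` to `x` at distance `t` from `q`
    let y := q + t / c * (x - q)
    have habs : |x - q| = c := by rw [hxq, Real.dist_eq]
    have hyq : dist y q = t := by
      rw [Real.dist_eq, add_sub_cancel_left, abs_mul, habs, abs_of_pos (by positivity)]
      field_simp
    have hxy : dist x y = c - t := by
      have : x - y = (c - t) / c * (x - q) := by simp only [y]; field_simp; ring
      rw [Real.dist_eq, this, abs_mul, habs, abs_of_pos (div_pos (by linarith [ht.2]) h0)]
      field_simp
    have hy : infDist y M = t := by
      apply le_antisymm
      · exact (infDist_le_dist_of_mem hq).trans hyq.le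
      · have := infDist_le_infDist_add_dist (x := x) (y := y) (s := M)
        rw [hxy] at this
        linarith
    exact ⟨y, by simpa [fatten, hy] using hts, by rw [hxy]; linarith⟩

/-- The iterated fattenings of `N`. -/
def tower (N : Set ℝ) : ℕ → Set ℝ
  | 0 => N
  | j + 1 => fatten (tower N j)

theorem monotone_tower (N : Set ℝ) : Monotone (tower N) :=
  monotone_nat_of_le_succ fun j => subset_fatten (tower N j)

theorem isClosed_tower {N : Set ℝ} (hN : IsClosed N) : ∀ j, IsClosed (tower N j)
  | 0 => hN
  | j + 1 => isClosed_fatten (tower N j)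

theorem tower_subset_closure_compl {N : Set ℝ} (hN : IsClosed N) (hne : N.Nonempty)
    (hN' : N ⊆ closure Nᶜ) : ∀ j, tower N j ⊆ closure (tower N j)ᶜ
  | 0 => hN'
  | j + 1 => fatten_subset_closure_compl (isClosed_tower hN j)
      (hne.mono (monotone_tower N (Nat.zero_le j))) (tower_subset_closure_compl hN hne hN' j)

theorem tower_subset_closure_diff {N : Set ℝ} (hN : IsClosed N) (hne : N.Nonempty)
    (hN' : N ⊆ closure Nᶜ) (j : ℕ) : tower N j ⊆ closure (tower N (j + 1) \ tower N j) :=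
  subset_closure_fatten_diff (isClosed_tower hN j) (tower_subset_closure_compl hN hne hN' j)

/-! ### The family of closed sets -/

/-- The points at a distance about `4⁻ᵏ` from `N`. -/
def shell (N : Set ℝ) (k : ℕ) : Set ℝ :=
  {x | infDist x N ∈ Icc (2 / 3 * (1 / 4 : ℝ) ^ k) (3 / 2 * (1 / 4 : ℝ) ^ k)}

/-- An open part of `shell N k`. -/
def openShell (N : Set ℝ) (k : ℕ) : Set ℝ :=
  {x | infDist x N ∈ Ioo (2 / 3 * (1 / 4 : ℝ) ^ k) (3 / 2 * (1 / 4 : ℝ) ^ k)}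

theorem isOpen_openShell (N : Set ℝ) (k : ℕ) : IsOpen (openShell N k) :=
  isOpen_Ioo.preimage (continuous_infDist_pt N)

theorem isClosed_shell (N : Set ℝ) (k : ℕ) : IsClosed (shell N k) :=
  isClosed_Icc.preimage (continuous_infDist_pt N)

theorem openShell_subset_shell (N : Set ℝ) (k : ℕ) : openShell N k ⊆ shell N k :=
  fun _ hx => Ioo_subset_Icc_self hx

theorem notMem_of_mem_shell {N : Set ℝ} {k : ℕ} {x : ℝ} (hx : x ∈ shell N k) : x ∉ N := by
  intro hxN
  have h : 2 / 3 * (1 / 4 : ℝ) ^ k ≤ infDist x N := hx.1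
  rw [infDist_zero_of_mem hxN] at h
  have : (0 : ℝ) < 2 / 3 * (1 / 4 : ℝ) ^ k := by positivity
  linarith

/-- Shells are disjoint because `3/2 · 1/4 < 2/3`. -/
theorem eq_of_mem_shell {N : Set ℝ} {k k' : ℕ} {x : ℝ} (hx : x ∈ shell N k)
    (hx' : x ∈ shell N k') : k = k' := by
  have key : ∀ {k k' : ℕ}, x ∈ shell N k → x ∈ shell N k' → ¬ k < k' := by
    intro k k' hx hx' hlt
    have h1 : 2 / 3 * (1 / 4 : ℝ) ^ k ≤ infDist x N := hx.1
    have h2 : infDist x N ≤ 3 / 2 * (1 / 4 : ℝ) ^ k' := hx'.2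
    have h3 : (1 / 4 : ℝ) ^ k' ≤ (1 / 4) ^ (k + 1) :=
      pow_le_pow_of_le_one (by norm_num) (by norm_num) hlt
    have h4 : (0 : ℝ) < (1 / 4 : ℝ) ^ k := by positivity
    rw [pow_succ] at h3
    linarith
  exact le_antisymm (not_lt.1 (key hx' hx)) (not_lt.1 (key hx hx'))

/-- A closed superset of `N` that follows, in the `k`-th shell around `N`, the `c k`-th iterated
fattening of `N`. -/
def shellUnion (N : Set ℝ) (c : ℕ → ℕ) : Set ℝ := N ∪ ⋃ k, shell N k ∩ tower N (c k)

/-- The shells accumulate only at `N`: outside a neighbourhood of `N` of radius `3/2 · 4⁻ⁿ` only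
finitely many pieces matter. -/
theorem isClosed_shellUnion {N : Set ℝ} (hN : IsClosed N) (hne : N.Nonempty) (c : ℕ → ℕ) :
    IsClosed (shellUnion N c) := by
  have : shellUnion N c = ⋂ n : ℕ, ({x | infDist x N ≤ 3 / 2 * (1 / 4 : ℝ) ^ n} ∪
      ⋃ k ∈ Iio n, shell N k ∩ tower N (c k)) := by
    ext x
    rw [mem_iInter]
    constructor
    · rintro (hx | hx) n
      · left
        simp only [mem_ofPred_eq, infDist_zero_of_mem hx]
        positivity
      · obtain ⟨k, hk, hk'⟩ := mem_iUnion.1 hx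
        rcases lt_or_ge k n with hkn | hkn
        · exact Or.inr (mem_biUnion (mem_Iio.2 hkn) ⟨hk, hk'⟩)
        · left
          have h2 : infDist x N ≤ 3 / 2 * (1 / 4 : ℝ) ^ k := hk.2
          have h3 : (1 / 4 : ℝ) ^ k ≤ (1 / 4) ^ n :=
            pow_le_pow_of_le_one (by norm_num) (by norm_num) hkn
          simp only [mem_ofPred_eq]
          linarith
    · intro hx
      by_cases hxN : x ∈ N
      · exact Or.inl hxN
      · have hpos := (hN.notMem_iff_infDist_pos hne).1 hxN
        obtain ⟨n, hn⟩ := exists_pow_lt_of_lt_one (show 0 < 2 / 3 * infDist x N by positivity)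
          (show (1 / 4 : ℝ) < 1 by norm_num)
        rcases hx n with h | h
        · simp only [mem_ofPred_eq] at h
          linarith
        · obtain ⟨k, -, hk⟩ := mem_iUnion₂.1 h
          exact Or.inr (mem_iUnion.2 ⟨k, hk⟩)
  rw [this]
  refine isClosed_iInter fun n => IsClosed.union ?_ ?_
  · exact isClosed_Iic.preimage (continuous_infDist_pt N)
  · exact (finite_Iio n).isClosed_biUnion fun k _ => (isClosed_shell N k).inter (isClosed_tower hN _)

theorem subset_shellUnion (N : Set ℝ) (c : ℕ → ℕ) : N ⊆ shellUnion N c := subset_union_left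

theorem mem_shellUnion_iff {N : Set ℝ} {c : ℕ → ℕ} {k : ℕ} {x : ℝ} (hx : x ∈ shell N k) :
    x ∈ shellUnion N c ↔ x ∈ tower N (c k) := by
  constructor
  · rintro (h | h)
    · exact absurd h (notMem_of_mem_shell hx)
    · obtain ⟨k', hk', h⟩ := mem_iUnion.1 h
      rwa [eq_of_mem_shell hx hk']
  · intro h
    exact Or.inr (mem_iUnion.2 ⟨k, hx, h⟩)

/-- Points at distance exactly `4⁻ᵏ` from `N` lie in the first fattening and in the `k`-th open
shell; for large `k ∈ K` they occur near each point of `N`. -/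
theorem subset_closure_openShell {N : Set ℝ} (hN : IsClosed N) (hN' : N ⊆ closure Nᶜ)
    {K : Set ℕ} (hK : K.Infinite) : N ⊆ closure (⋃ k ∈ K, openShell N k ∩ tower N 1) := by
  intro p hp
  rw [Metric.mem_closure_iff]
  intro ε hε
  obtain ⟨h, h0, hh⟩ := exists_infDist_eq hN hN' hp hε
  obtain ⟨n, hn⟩ := exists_pow_lt_of_lt_one h0 (show (1 / 4 : ℝ) < 1 by norm_num)
  obtain ⟨k, hk, hnk⟩ := hK.exists_gt n
  have hpos : (0 : ℝ) < (1 / 4 : ℝ) ^ k := by positivity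
  obtain ⟨x, hxp, hx⟩ := hh ((1 / 4) ^ k) ⟨hpos.le,
    (pow_le_pow_of_le_one (by norm_num) (by norm_num) hnk.le).trans hn.le⟩
  refine ⟨x, mem_biUnion hk ⟨?_, Or.inr ⟨k, hx.symm⟩⟩, by rwa [dist_comm]⟩
  simp only [openShell, mem_ofPred_eq, hx]
  constructor <;> linarith

/-- Induction on `l`, raising the level `j`. In a shell with index in `K` the head of the list is
level `j + 1` of the tower, which lies in the closure of level `j + 2` minus level `j + 1`; openness
of the shell keeps the approximating points inside it. The points of `N` are then limits of points
in these shells, as `K` is infinite. -/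
theorem subset_chainSet {N : Set ℝ} (hN : IsClosed N) (hne : N.Nonempty) (hN' : N ⊆ closure Nᶜ)
    {K : Set ℕ} (hK : K.Infinite) (l : List (ℕ → ℕ)) (j : ℕ)
    (hl : ∀ k ∈ K, ∀ i (h : i < l.length), l[i] k = j + i + 1) :
    N ∪ ⋃ k ∈ K, openShell N k ∩ tower N (j + 1) ⊆ chainSet (l.map (shellUnion N)) := by
  induction l generalizing j with
  | nil => exact subset_univ _
  | cons c l ih =>
    have hc : ∀ k ∈ K, c k = j + 1 := fun k hk => hl k hk 0 (by simp)
    have ih' := ih (j + 1) fun k hk i hi => by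
      have := hl k hk (i + 1) (by simpa using hi)
      rw [List.getElem_cons_succ] at this
      omega
    have hshell : ⋃ k ∈ K, openShell N k ∩ tower N (j + 1) ⊆
        closure (chainSet (l.map (shellUnion N)) \ shellUnion N c) := by
      refine iUnion₂_subset fun k hk => ?_
      rintro x ⟨hxo, hxt⟩
      have hx := (isOpen_openShell N k).inter_closure
        ⟨hxo, tower_subset_closure_diff hN hne hN' (j + 1) hxt⟩
      refine closure_mono ?_ hx
      rintro y ⟨hyo, hyt, hyt'⟩
      refine ⟨ih' (Or.inr (mem_biUnion hk ⟨hyo, hyt⟩)), ?_⟩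
      rw [mem_shellUnion_iff (openShell_subset_shell N k hyo), hc k hk]
      exact hyt'
    refine union_subset (subset_inter (subset_shellUnion N c) ?_) (subset_inter ?_ hshell)
    · refine (subset_closure_openShell hN hN' hK).trans (closure_minimal ?_ isClosed_closure)
      refine Subset.trans ?_ hshell
      exact iUnion₂_mono fun k _ => inter_subset_inter_right _ (monotone_tower N (by omega))
    · refine iUnion₂_subset fun k hk => ?_
      rintro x ⟨hxo, hxt⟩
      rw [mem_shellUnion_iff (openShell_subset_shell N k hxo), hc k hk]
      exact hxt

/-- Below a prime filter of closed sets of `ℝ` that contains a set and the closure of its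
complement there are chains of each order type of cardinality at most that of the continuum. -/
theorem IsPrimeClosedFilter.exists_strictAnti {I : Type*} [LinearOrder I] (ι : I ↪ (ℕ → Bool))
    {P : Set (Set ℝ)} (hP : IsPrimeClosedFilter P) {Z : Set ℝ} (hZ : Z ∈ P)
    (hZ' : closure Zᶜ ∈ P) :
    ∃ Q : I → Set (Set ℝ), StrictAnti Q ∧ (∀ i, IsPrimeClosedFilter (Q i)) ∧
      ∀ i, IsMin i → Q i = P := by
  have hNP : Z ∩ closure Zᶜ ∈ P := hP.inter_mem _ hZ _ hZ'
  set N := Z ∩ closure Zᶜ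
  have hN : IsClosed N := hP.isClosed _ hNP
  have hne : N.Nonempty := nonempty_iff_ne_empty.2 fun h => hP.empty_notMem (h ▸ hNP)
  have hN' : N ⊆ closure Nᶜ := fun x hx => closure_mono (compl_subset_compl.2 inter_subset_left) hx.2
  have hcl : ∀ i, IsClosed (shellUnion N (indep (ι i))) := fun i => isClosed_shellUnion hN hne _
  refine exists_chain (E := fun i => shellUnion N (indep (ι i))) hcl hP fun l hl => ?_
  have hK := infinite_indep_eq (l.map ι) (hl.map ι.injective)
  have := subset_chainSet hN hne hN' hK ((l.map ι).map indep) 0 fun k hk i hi => by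
    have := hk i (by simpa using hi)
    simpa using this
  rw [List.map_map, List.map_map] at this
  refine hP.superset_mem N hNP _ (isClosed_chainSet _ ?_) (subset_union_left.trans this)
  intro E hE
  obtain ⟨i, -, rfl⟩ := List.mem_map.1 hE
  exact hcl i

end PrimeZ

namespace PrimeZ

open Set Filter Topology

/-! ### Zero sets on the real line -/

/-- Each closed subset of `ℝ` is the zero set of a nonnegative function of `C₀(ℝ, 𝕜)`. -/
theorem exists_zeroAtInfty_eq {𝕜 : Type*} [RCLike 𝕜] {Z : Set ℝ} (hZ : IsClosed Z) :
    ∃ f : C₀(ℝ, 𝕜), {x | f x = 0} = Z := by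
  obtain ⟨φ, hφ, hφ1, hφZ⟩ : ∃ φ : ℝ → ℝ, Continuous φ ∧ (∀ x, |φ x| ≤ 1) ∧
      ∀ x, φ x = 0 ↔ x ∈ Z := by
    rcases Z.eq_empty_or_nonempty with rfl | hne
    · exact ⟨fun _ => 1, continuous_const, by simp, by simp⟩
    · refine ⟨fun x => min (Metric.infDist x Z) 1, (Metric.continuous_infDist_pt Z).min
        continuous_const, fun x => ?_, fun x => ?_⟩
      · rw [abs_of_nonneg (le_min Metric.infDist_nonneg zero_le_one)]
        exact min_le_right _ _
      · rw [hZ.mem_iff_infDist_zero hne]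
        constructor
        · intro h
          dsimp only at h
          rcases min_choice (Metric.infDist x Z) 1 with h' | h' <;> rw [h'] at h
          · exact h
          · norm_num at h
        · intro h
          simp [h]
  have hpos : ∀ x : ℝ, 0 < 1 + ‖x‖ := fun x => by positivity
  have hcont : Continuous fun x : ℝ => φ x * (1 + ‖x‖)⁻¹ :=
    hφ.mul ((continuous_const.add continuous_norm).inv₀ fun x => (hpos x).ne')
  have hlim : Tendsto (fun x : ℝ => φ x * (1 + ‖x‖)⁻¹) (cocompact ℝ) (𝓝 0) := by
    have h0 : Tendsto (fun x : ℝ => (1 + ‖x‖)⁻¹) (cocompact ℝ) (𝓝 0) :=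
      tendsto_inv_atTop_zero.comp
        (tendsto_atTop_add_const_left _ _ (tendsto_norm_cocompact_atTop (E := ℝ)))
    refine squeeze_zero_norm (fun x => ?_) h0
    rw [norm_mul, Real.norm_eq_abs, Real.norm_of_nonneg (inv_nonneg.2 (hpos x).le)]
    exact mul_le_of_le_one_left (inv_nonneg.2 (hpos x).le) (hφ1 x)
  refine ⟨⟨⟨fun x => ((φ x * (1 + ‖x‖)⁻¹ : ℝ) : 𝕜), RCLike.continuous_ofReal.comp hcont⟩, ?_⟩, ?_⟩
  · have := (RCLike.continuous_ofReal (K := 𝕜)).tendsto 0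
    rw [RCLike.ofReal_zero] at this
    exact this.comp hlim
  · ext x
    change ((φ x * (1 + ‖x‖)⁻¹ : ℝ) : 𝕜) = 0 ↔ _
    rw [RCLike.ofReal_eq_zero, ← hφZ x, mul_eq_zero, or_iff_left (inv_ne_zero (hpos x).ne')]

theorem isClosed_setOf_eq_zero {𝕜 : Type*} [RCLike 𝕜] (f : C₀(ℝ, 𝕜)) : IsClosed {x | f x = 0} :=
  isClosed_eq (map_continuous f) continuous_const

theorem mem_zeroSets_iff {Z : Set ℝ} : Z ∈ zeroSets ℝ ↔ IsClosed Z := by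
  constructor
  · rintro ⟨f, rfl⟩
    exact isClosed_eq f.continuous continuous_const
  · intro hZ
    obtain ⟨f, hf⟩ := exists_zeroAtInfty_eq (𝕜 := ℝ) hZ
    exact ⟨f.toContinuousMap, hf.symm⟩

theorem isPrimeZFilter_iff {F : Set (Set ℝ)} : IsPrimeZFilter F ↔ IsPrimeClosedFilter F := by
  constructor
  · rintro ⟨⟨⟨Z₀, hZ₀⟩, hss, hinter, hsup⟩, hprime⟩
    have hcl : ∀ Z ∈ F, IsClosed Z := fun Z hZ => mem_zeroSets_iff.1 (hss.1 hZ)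
    refine ⟨hcl, ?_, ?_, hinter, ?_, ?_⟩
    · exact hsup Z₀ hZ₀ univ (mem_zeroSets_iff.2 isClosed_univ) (subset_univ _)
    · exact fun h => hss.2 fun W hW => hsup ∅ h W hW (empty_subset _)
    · exact fun Z hZ W hW => hsup Z hZ W (mem_zeroSets_iff.2 hW)
    · intro Z W hZ hW h
      by_contra! hcon
      exact hprime Z (mem_zeroSets_iff.2 hZ) W (mem_zeroSets_iff.2 hW) hcon.1 hcon.2 h
  · intro h
    refine ⟨⟨⟨univ, h.univ_mem⟩, ⟨fun Z hZ => mem_zeroSets_iff.2 (h.isClosed Z hZ), ?_⟩,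
      h.inter_mem, ?_⟩, ?_⟩
    · exact fun hsub => h.empty_notMem (hsub (mem_zeroSets_iff.2 isClosed_empty))
    · exact fun Z hZ W hW => h.superset_mem Z hZ W (mem_zeroSets_iff.1 hW)
    · intro Z hZ W hW hZF hWF hmem
      exact (h.mem_or_mem Z W (mem_zeroSets_iff.1 hZ) (mem_zeroSets_iff.1 hW) hmem).elim hZF hWF

/-! ### Prime `z`-ideals and prime filters of closed sets -/

section Ideal

variable {𝕜 : Type*} [RCLike 𝕜]

/-- The zero sets of the functions of an ideal. -/
def zeroSetsOf (P : TwoSidedIdeal C₀(ℝ, 𝕜)) : Set (Set ℝ) := {Z | ∃ f ∈ P, {x | f x = 0} = Z}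

theorem setOf_mul_eq_zero (f g : C₀(ℝ, 𝕜)) :
    {x | (f * g) x = 0} = {x | f x = 0} ∪ {x | g x = 0} := by
  ext x
  simp

/-- An ideal contains with `f` and `g` a function whose zeros are the common zeros. -/
theorem exists_mem_setOf_eq_inter {P : TwoSidedIdeal C₀(ℝ, 𝕜)} {f g : C₀(ℝ, 𝕜)} (hf : f ∈ P)
    (hg : g ∈ P) : ∃ h ∈ P, {x | h x = 0} = {x | f x = 0} ∩ {x | g x = 0} := by
  -- This is `|f|² + |g|²`, for real and complex scalars alike.
  refine ⟨star f * f + star g * g, P.add_mem (P.mul_mem_left _ _ hf) (P.mul_mem_left _ _ hg), ?_⟩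
  ext x
  simp only [mem_ofPred_eq, mem_inter_iff, ZeroAtInftyContinuousMap.add_apply,
    ZeroAtInftyContinuousMap.mul_apply, ZeroAtInftyContinuousMap.star_apply, RCLike.star_def,
    RCLike.conj_mul]
  norm_cast
  rw [add_eq_zero_iff_of_nonneg (by positivity) (by positivity)]
  simp

theorem mem_iff_mem_zeroSetsOf {P : TwoSidedIdeal C₀(ℝ, 𝕜)} (hz : IsZIdeal P) {f : C₀(ℝ, 𝕜)} :
    f ∈ P ↔ {x | f x = 0} ∈ zeroSetsOf P := by
  refine ⟨fun hf => ⟨f, hf, rfl⟩, ?_⟩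
  rintro ⟨g, hg, hgf⟩
  exact hz g hg f hgf.le

theorem isPrimeClosedFilter_zeroSetsOf {P : TwoSidedIdeal C₀(ℝ, 𝕜)} (hP : IsPrimeIdeal P)
    (hz : IsZIdeal P) : IsPrimeClosedFilter (zeroSetsOf P) where
  isClosed := by
    rintro _ ⟨f, -, rfl⟩
    exact isClosed_setOf_eq_zero f
  univ_mem := ⟨0, P.zero_mem, by simp⟩
  empty_notMem := by
    rintro ⟨f, hf, h⟩
    refine hP.ne_top (eq_top_iff.2 fun g _ => hz f hf g ?_)
    rw [h]
    exact empty_subset _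
  inter_mem := by
    rintro _ ⟨f, hf, rfl⟩ _ ⟨g, hg, rfl⟩
    exact exists_mem_setOf_eq_inter hf hg
  superset_mem := by
    rintro _ ⟨f, hf, rfl⟩ W hW hfW
    obtain ⟨g, rfl⟩ := exists_zeroAtInfty_eq (𝕜 := 𝕜) hW
    exact ⟨g, hz f hf g hfW, rfl⟩
  mem_or_mem := by
    intro Z W hZ hW h
    obtain ⟨f, rfl⟩ := exists_zeroAtInfty_eq (𝕜 := 𝕜) hZ
    obtain ⟨g, rfl⟩ := exists_zeroAtInfty_eq (𝕜 := 𝕜) hW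
    rw [← setOf_mul_eq_zero, ← mem_iff_mem_zeroSetsOf hz] at h
    exact (hP.mem_or_mem f g h).imp (fun hf => ⟨f, hf, rfl⟩) fun hg => ⟨g, hg, rfl⟩

/-- The ideal of the functions whose zero sets belong to a prime filter of closed sets. -/
def idealOf (𝕜 : Type*) [RCLike 𝕜] {F : Set (Set ℝ)} (hF : IsPrimeClosedFilter F) :
    TwoSidedIdeal C₀(ℝ, 𝕜) :=
  .mk' {f | {x | f x = 0} ∈ F}
    (by simpa using hF.univ_mem)
    (fun {f g} hf hg => hF.superset_mem _ (hF.inter_mem _ hf _ hg) _ (isClosed_setOf_eq_zero _)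
      (by
        rintro x ⟨hx, hx'⟩
        simp only [mem_ofPred_eq] at hx hx'
        simp [hx, hx']))
    (fun {f} hf => by simpa using hf)
    (fun {f g} hg => hF.superset_mem _ hg _ (isClosed_setOf_eq_zero _)
      (by rw [setOf_mul_eq_zero]; exact subset_union_right))
    (fun {f g} hf => hF.superset_mem _ hf _ (isClosed_setOf_eq_zero _)
      (by rw [setOf_mul_eq_zero]; exact subset_union_left))

theorem mem_idealOf {F : Set (Set ℝ)} {hF : IsPrimeClosedFilter F} {f : C₀(ℝ, 𝕜)} :
    f ∈ idealOf 𝕜 hF ↔ {x | f x = 0} ∈ F :=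
  TwoSidedIdeal.mem_mk' _ _ _ _ _ _ _

theorem isPrimeIdeal_idealOf {F : Set (Set ℝ)} (hF : IsPrimeClosedFilter F) :
    IsPrimeIdeal (idealOf 𝕜 hF) where
  ne_top h := by
    obtain ⟨f, hf⟩ := exists_zeroAtInfty_eq (𝕜 := 𝕜) isClosed_empty
    have : f ∈ idealOf 𝕜 hF := h ▸ trivial
    rw [mem_idealOf, hf] at this
    exact hF.empty_notMem this
  mem_or_mem f g h := by
    rw [mem_idealOf, setOf_mul_eq_zero] at h
    simp only [mem_idealOf]
    exact hF.mem_or_mem _ _ (isClosed_setOf_eq_zero f) (isClosed_setOf_eq_zero g) h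

theorem isZIdeal_idealOf {F : Set (Set ℝ)} (hF : IsPrimeClosedFilter F) :
    IsZIdeal (idealOf 𝕜 hF) := by
  intro f hf g hfg
  rw [mem_idealOf] at hf ⊢
  exact hF.superset_mem _ hf _ (isClosed_setOf_eq_zero g) hfg

theorem idealOf_lt_idealOf {F G : Set (Set ℝ)} (hF : IsPrimeClosedFilter F)
    (hG : IsPrimeClosedFilter G) (h : F ⊂ G) : idealOf 𝕜 hF < idealOf 𝕜 hG := by
  rw [TwoSidedIdeal.lt_iff]
  refine ⟨fun f hf => mem_idealOf.2 (h.1 (mem_idealOf.1 hf)), fun hsub => h.2 fun Z hZ => ?_⟩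
  obtain ⟨f, rfl⟩ := exists_zeroAtInfty_eq (𝕜 := 𝕜) (hG.isClosed Z hZ)
  exact mem_idealOf.1 (hsub (mem_idealOf.2 hZ))

end Ideal

/-! ### Ordinals of cardinality continuum and the main theorem. -/

theorem nonempty_Iio_embedding {κ : Ordinal.{u}} (hκ : κ.card = Cardinal.continuum) :
    Nonempty (Set.Iio κ ↪ (ℕ → Bool)) := by
  rw [← Cardinal.lift_mk_le', Cardinal.mk_Iio_ordinal, hκ]
  simp

end PrimeZ

theorem corollary4p6 (κ : Ordinal.{u}) (hκ : κ.card = Cardinal.continuum) :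
    (∀ P : Set (Set ℝ), PrimeZ.IsPrimeZFilter P →
      -- `P` is not a minimal prime `z`-filter
      (∃ P' : Set (Set ℝ), PrimeZ.IsPrimeZFilter P' ∧ P' ⊂ P) →
      ∃ Q : Set.Iio κ → Set (Set ℝ), StrictAnti Q ∧ (∀ α, PrimeZ.IsPrimeZFilter (Q α)) ∧
        ∃ h : 0 < κ, Q ⟨0, h⟩ = P) ∧
    (∀ (𝕜 : Type v) [RCLike 𝕜] (P : TwoSidedIdeal C₀(ℝ, 𝕜)),
      PrimeZ.IsPrimeIdeal P → PrimeZ.IsZIdeal P →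
      -- `P` is not a minimal prime ideal
      (∃ P' : TwoSidedIdeal C₀(ℝ, 𝕜), PrimeZ.IsPrimeIdeal P' ∧ P' < P) →
      ∃ Q : Set.Iio κ → TwoSidedIdeal C₀(ℝ, 𝕜), StrictAnti Q ∧
        (∀ α, PrimeZ.IsPrimeIdeal (Q α) ∧ PrimeZ.IsZIdeal (Q α)) ∧
        ∃ h : 0 < κ, Q ⟨0, h⟩ = P) := by
  have hκ0 : 0 < κ := by
    rw [pos_iff_ne_zero]
    rintro rfl
    simp [eq_comm, Cardinal.continuum_ne_zero] at hκ
  have hmin : IsMin (⟨0, hκ0⟩ : Set.Iio κ) := fun β _ => zero_le (a := (β : Ordinal))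
  obtain ⟨ι⟩ := PrimeZ.nonempty_Iio_embedding hκ
  refine ⟨fun P hP hnm => ?_, fun 𝕜 _ P hP hz hnm => ?_⟩
  · obtain ⟨P', hP', hlt⟩ := hnm
    rw [PrimeZ.isPrimeZFilter_iff] at hP hP'
    obtain ⟨Z, hZ, hZ'⟩ := Set.exists_of_ssubset hlt
    have hcl : closure Zᶜ ∈ P := by
      refine hlt.1 ((hP'.mem_or_mem Z _ (hP.isClosed Z hZ) isClosed_closure ?_).resolve_left hZ')
      have : Z ∪ closure Zᶜ = Set.univ :=
        Set.eq_univ_of_forall fun x => (em (x ∈ Z)).imp id fun h => subset_closure h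
      rw [this]
      exact hP'.univ_mem
    obtain ⟨Q, hQ, hQp, hQ0⟩ := hP.exists_strictAnti ι hZ hcl
    exact ⟨Q, hQ, fun α => PrimeZ.isPrimeZFilter_iff.2 (hQp α), hκ0, hQ0 _ hmin⟩
  · obtain ⟨P', hP', hlt⟩ := hnm
    rw [TwoSidedIdeal.lt_iff] at hlt
    obtain ⟨f, hf, hf'⟩ := Set.exists_of_ssubset hlt
    have hF := PrimeZ.isPrimeClosedFilter_zeroSetsOf hP hz
    -- `P'` need not be a `z`-ideal, so the argument uses functions: some `g` vanishing exactly on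
    -- this closure has `f * g = 0 ∈ P'`, whence `g ∈ P' ⊆ P`.
    have hcl : closure {x | f x = 0}ᶜ ∈ PrimeZ.zeroSetsOf P := by
      obtain ⟨g, hg⟩ := PrimeZ.exists_zeroAtInfty_eq (𝕜 := 𝕜) (Z := closure {x | f x = 0}ᶜ)
        isClosed_closure
      have hfg : f * g = 0 := by
        ext x
        by_cases hx : f x = 0
        · simp [hx]
        · have : x ∈ {x | g x = 0} := hg ▸ subset_closure hx
          simp only [Set.mem_ofPred_eq] at this
          simp [this]
      refine ⟨g, hlt.1 ((hP'.mem_or_mem f g ?_).resolve_left hf'), hg⟩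
      rw [hfg]
      exact P'.zero_mem
    obtain ⟨Q, hQ, hQp, hQ0⟩ := hF.exists_strictAnti ι ⟨f, hf, rfl⟩ hcl
    refine ⟨fun α => PrimeZ.idealOf 𝕜 (hQp α), fun α β h => PrimeZ.idealOf_lt_idealOf _ _ (hQ h),
      fun α => ⟨PrimeZ.isPrimeIdeal_idealOf _, PrimeZ.isZIdeal_idealOf _⟩, hκ0, ?_⟩
    have h0 := hQ0 _ hmin
    refine TwoSidedIdeal.ext fun g => ?_
    rw [PrimeZ.mem_idealOf, h0, ← PrimeZ.mem_iff_mem_zeroSetsOf hz]
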